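/- **Setting.** There are $N$ products. Quantities, prices, revenues and expenditure are in logs, and log quantities range over $\mathbb R$. Let $Z$ be the set of values of an observed demand shifter, and let demand shocks take values in $[0,1]$. An HSA demand system is a pair $(\mathfrak s^*,q)$ of a log budget-share function $\mathfrak s^*:\mathbb R\times Z\times[0,1]\to\mathbb R$ and a quantity index $q(\mathbf y,\mathbf z,\mathbf u)$ such that, for all $\mathbf y\in\mathbb R^N$, $\mathbf z\in Z^N$, $\mathbf u\in[0,1]^N$, $$\sum_{i=1}^N \exp\big(\mathfrak s^*(y_i-q(\mathbf y,\mathbf z,\mathbf u),z_i,u_i)\big)=1 .$$ At log expenditure $\Phi$ its log inverse demand is $p_i=\Phi+\mathfrak s^*(y_i-q(\mathbf y,\mathbf z,\mathbf u),z_i,u_i)-y_i$. Observed log revenues $r_1,\dots,r_N$ come from this system at a baseline state $(\mathbf y^0,\mathbf z^0,\mathbf u^0)$: $\ln\big(e^{r_i}/\sum_j e^{r_j}\big)=\mathfrak s^*(y^0_i-q(\mathbf y^0,\mathbf z^0,\mathbf u^0),z^0_i,u^0_i)$ for all $i$, with the normalization $q(\mathbf y^0,\mathbf z^0,\mathbf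 u^0)=0$. Put $\Phi_0=\ln\sum_j e^{r_j}$. Firms take $q(\mathbf y^0,\mathbf z^0,\mathbf u^0)$ and $\Phi_0$ as given, so the reduced-form revenue function is $\varphi(y,z,u)=\Phi_0+\mathfrak s^*(y-q(\mathbf y^0,\mathbf z^0,\mathbf u^0),z,u)$. Assume that for all $(z,u)$ revenue $y\mapsto\varphi(y,z,u)$ is strictly increasing and inverse demand $y\mapsto\varphi(y,z,u)-y$ is strictly decreasing. The function $\varphi$ is known up to the location of $\varphi^{-1}(\cdot,z,u)$: the known revenue function $\hat\varphi$ has, for every $(z,u)$, the same range as $\varphi$ and satisfies $\hat\varphi^{-1}(r,z,u)=a+\varphi^{-1}(r,z,u)$ there, for some $a\in\mathbb R$ not depending on $(r,z,u)$. Put $\hat{\mathfrak s}=\hat\varphi-\Phi_0$, and let $\Delta\hat q$ solve $$\sum_{i=1}^N\exp\big(\hat{\mathfrak s}(y_i-\Delta\hat q(\mathbf y,\mathbf z,\mathbf u),z_i,u_i)\big)=1\quad\text{for all }(\mathbf y,\mathbf z,\mathbf u).$$ (For $a=0$ these are $\mathfrak s=\varphi-\Phi_0$ and $\Delta q=q-q(\mathbf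 y^0,\mathbf z^0,\mathbf u^0)$.) A preference is a binary relation $\succsim$ on $\mathbb R^N$ (log consumption vectors). It is *rational* if complete and transitive; *monotone* if $y_i>x_i$ for all $i$ implies $\mathbf y\succ\mathbf x$; *convex* if, for each $\mathbf x$, the set of quantity vectors $(e^{y_1},\dots,e^{y_N})$ with $\mathbf y\succsim\mathbf x$ is convex; *continuous* if all upper and lower contour sets are closed; *homothetic* if $\mathbf x\succsim\mathbf y$ implies $\mathbf x+c\mathbf 1\succsim\mathbf y+c\mathbf 1$ for all $c\in\mathbb R$. It *generates* a demand system at $(\mathbf z,\mathbf u)$ if, for all log prices $\mathbf p$, log expenditures $\Phi$ and $\mathbf y$, the vector $\mathbf y$ is a $\succsim$-best element of $\{\mathbf x:\sum_i e^{p_i+x_i}\le e^{\Phi}\}$ if and only if $\mathbf p$ is the log inverse demand of the system at $(\Phi,\mathbf y,\mathbf z,\mathbf u)$. **Claim.** For every $a$ and $\hat\varphi$ as above, $\Delta\hat q$ exists and is unique. For every $(\mathbf z,\mathbf u)$: (a) There is a unique monotone, convex, continuous, homothetic rational preference $\succsim$ that generates the HSA demand system $(\mathfrak s^*,q)$ at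 $(\mathbf z,\mathbf u)$. (b) There is a rule, not depending on the industry, that computes from $(\hat{\mathfrak s},\Delta\hat q)$ and $(\mathbf z,\mathbf u)$ a vector $\mathbf b\in\mathbb R^N$ such that $$\ln U(\mathbf y)=\Delta\hat q(\mathbf y,\mathbf z,\mathbf u)+\sum_{i=1}^N\int_{b_i}^{y_i-\Delta\hat q(\mathbf y,\mathbf z,\mathbf u)}\exp\big(\hat{\mathfrak s}(\zeta,z_i,u_i)\big)\,d\zeta$$ represents $\succsim$, satisfies $\ln U(\mathbf y+c\mathbf 1)=\ln U(\mathbf y)+c$ for all $\mathbf y$ and $c$, and has $\ln U(\mathbf b)=0$. In particular this holds for $\hat{\mathfrak s}=\mathfrak s$, $\Delta\hat q=\Delta q$. (c) The demand system and the preference do not depend on the location normalization $a$: one has $\Delta\hat q=\Delta q-a$; the log inverse demand of $(\hat{\mathfrak s},\Delta\hat q)$ is the same function of $(\Phi,\mathbf y)$ as that of $(\mathfrak s^*,q)$, and measuring log quantities as $\mathbf y+a\mathbf 1$ changes the log prices to $\mathbf p-a\mathbf 1$; and the same $\succsim$ is the unique monotone, convex, continuous, homothetic rational preference that generates $(\hat{\mathfrak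 s},\Delta\hat q)$ at $(\mathbf z,\mathbf u)$. -/

import Mathlib

open scoped unitInterval

noncomputable section

namespace HSA

/-- Log budget-share functions: log (relative) output, observed demand shifter, demand shock. -/
abbrev ShareFn (Z : Type*) := ℝ → Z → I → ℝ

/-- Quantity indices: functions of the aggregate state `(y, z, u)`, with `y` the vector of log
quantities. -/
abbrev IndexFn (N : ℕ) (Z : Type*) := (Fin N → ℝ) → (Fin N → Z) → (Fin N → I) → ℝ

/-- The adding-up constraint on market shares, at every aggregate state. -/
def AddingUp {N : ℕ} {Z : Type*} (s : ShareFn Z) (q : IndexFn N Z) : Prop :=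
  ∀ y z u, ∑ i, Real.exp (s (y i - q y z u) (z i) (u i)) = 1

/-- The inverse demand system of `(s, q)`: the log price of product `i` when log expenditure is
`Φ` and the log quantities are `y`. -/
def logPrice {N : ℕ} {Z : Type*} (s : ShareFn Z) (q : IndexFn N Z) (z : Fin N → Z)
    (u : Fin N → I) (Φ : ℝ) (y : Fin N → ℝ) (i : Fin N) : ℝ :=
  Φ + s (y i - q y z u) (z i) (u i) - y i

/-- The log utility function built from a log budget-share function, a quantity index and
lower limits of integration `b`. -/
def logUtility {N : ℕ} {Z : Type*} (s : ShareFn Z) (q : IndexFn N Z) (b : Fin N → ℝ)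
    (z : Fin N → Z) (u : Fin N → I) (y : Fin N → ℝ) : ℝ :=
  q y z u + ∑ i, ∫ ζ in (b i)..(y i - q y z u), Real.exp (s ζ (z i) (u i))

/-- The inverse `φ⁻¹(r, z, u)` of a revenue function in its first argument; it is meaningful for
`r` in the range of `φ(·, z, u)`. -/
def revInv {Z : Type*} (φ : ShareFn Z) (r : ℝ) (z : Z) (u : I) : ℝ :=
  Function.invFun (fun y => φ y z u) r

/-- `φ'` is `φ` under another location normalization: `φ'⁻¹ = a + φ⁻¹`. -/
def IsLocationShift {Z : Type*} (a : ℝ) (φ φ' : ShareFn Z) : Prop :=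
  ∀ z u, Set.range (fun y => φ' y z u) = Set.range (fun y => φ y z u) ∧
    ∀ r ∈ Set.range (fun y => φ y z u), revInv φ' r z u = a + revInv φ r z u

/-- A monotone, convex, continuous and homothetic rational preference over strictly positive
consumption bundles, written in logs: `R y x` says that the bundle with log quantities `y` is at
least as good as the one with log quantities `x`. Convexity is convexity of the upper contour
sets in quantities; scaling a bundle by `exp c` adds `c` to all log quantities. -/
structure IsRegularPreference {N : ℕ} (R : (Fin N → ℝ) → (Fin N → ℝ) → Prop) : Prop where
  complete : ∀ x y, R x y ∨ R y x
  transitive : ∀ x y w, R x y → R y w → R x w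
  monotone : ∀ x y, (∀ i, x i < y i) → R y x ∧ ¬ R x y
  convex : ∀ x, Convex ℝ ((fun (y : Fin N → ℝ) (i : Fin N) => Real.exp (y i)) '' {y | R y x})
  closed_upper : ∀ x, IsClosed {y | R y x}
  closed_lower : ∀ x, IsClosed {y | R x y}
  homothetic : ∀ x y (c : ℝ), R x y → R (fun i => x i + c) (fun i => y i + c)

/-- The budget set, in log quantities, at log prices `p` and log expenditure `Φ`. -/
def budget {N : ℕ} (p : Fin N → ℝ) (Φ : ℝ) : Set (Fin N → ℝ) :=
  {y | ∑ i, Real.exp (p i + y i) ≤ Real.exp Φ}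

/-- `y` is a best affordable bundle for `R` at log prices `p` and log expenditure `Φ`. -/
def IsDemanded {N : ℕ} (R : (Fin N → ℝ) → (Fin N → ℝ) → Prop) (p : Fin N → ℝ) (Φ : ℝ)
    (y : Fin N → ℝ) : Prop :=
  y ∈ budget p Φ ∧ ∀ x ∈ budget p Φ, R y x

/-- The preference `R` generates the demand system `(s, q)` at the demand shifters `(z, u)`:
its demand correspondence and the demand system have the same graph. -/
def Generates {N : ℕ} {Z : Type*} (R : (Fin N → ℝ) → (Fin N → ℝ) → Prop) (s : ShareFn Z)
    (q : IndexFn N Z) (z : Fin N → Z) (u : Fin N → I) : Prop :=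
  ∀ (p : Fin N → ℝ) (Φ : ℝ) (y : Fin N → ℝ),
    IsDemanded R p Φ y ↔ ∀ i, p i = logPrice s q z u Φ y i

/-- `V` represents `R`. -/
def Represents {N : ℕ} (V : (Fin N → ℝ) → ℝ) (R : (Fin N → ℝ) → (Fin N → ℝ) → Prop) : Prop :=
  ∀ x y, R x y ↔ V y ≤ V x

/-- An industry with `N` products under an HSA demand system, observed in equilibrium at a
baseline state. Only the ingredients of the HSA system and the observed revenues are data; the
reduced-form revenue function is derived from them below. -/
structure Industry (N : ℕ) (Z : Type*) where
  /-- structural log budget-share function -/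
  share : ShareFn Z
  /-- quantity index -/
  index : IndexFn N Z
  /-- baseline log outputs -/
  y₀ : Fin N → ℝ
  /-- baseline observed demand shifters -/
  z₀ : Fin N → Z
  /-- baseline demand shocks -/
  u₀ : Fin N → I
  /-- observed log revenues -/
  r : Fin N → ℝ

namespace Industry

variable {N : ℕ} {Z : Type*} (E : Industry N Z)

/-- Log aggregate expenditure at the baseline. -/
def Φ : ℝ := Real.log (∑ j, Real.exp (E.r j))

/-- Reduced-form log revenue function: expenditure and the quantity index, which firms take as
given, are held at the baseline. -/
def rev : ShareFn Z := fun y z u => E.Φ + E.share (y - E.index E.y₀ E.z₀ E.u₀) z u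

/-- Reduced-form log inverse demand function. -/
def invDemand : ShareFn Z := fun y z u => E.rev y z u - y

/-- Change of the quantity index relative to the baseline. -/
def indexChange : IndexFn N Z := fun y z u => E.index y z u - E.index E.y₀ E.z₀ E.u₀

/-- The maintained assumptions. -/
structure Assumptions : Prop where
  /-- the quantity index is determined by adding up of the market shares -/
  adding_up : AddingUp E.share E.index
  /-- the observed revenues are those of the HSA demand system at the baseline state -/
  baseline : ∀ i, Real.log (Real.exp (E.r i) / ∑ j, Real.exp (E.r j)) =
    E.share (E.y₀ i - E.index E.y₀ E.z₀ E.u₀) (E.z₀ i) (E.u₀ i)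
  /-- normalization of the quantity index -/
  normalized : E.index E.y₀ E.z₀ E.u₀ = 0
  /-- revenue is strictly increasing in output -/
  rev_strictMono : ∀ z u, StrictMono fun y => E.rev y z u
  /-- inverse demand is strictly decreasing in output -/
  invDemand_strictAnti : ∀ z u, StrictAnti fun y => E.invDemand y z u

end Industry

/-- The reduced-form log budget-share function obtained from a revenue function `φ` and log
aggregate expenditure `Φ`. -/
def reducedShare {Z : Type*} (φ : ShareFn Z) (Φ : ℝ) : ShareFn Z := fun y z u => φ y z u - Φ

end HSA

end

/-!
A continuous homothetic preference has a log utility `U` with `U (y + c𝟏) = U y + c`. For such a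
`U`, the bundle `y` is demanded at prices `w` and unit expenditure exactly when `y` costs one unit
and `U x - U y ≤ log (∑ i, w i * exp (x i))` for all `x`.

For an HSA system and `U y = q + ∑ i, ∫ exp (sᵢ)`, with upper limits `yᵢ - q`, this bound holds at
the inverse demand `wᵢ = exp (sᵢ (yᵢ - q) - yᵢ)`: as shares increase, adding up makes `q` the
minimizer of `t ↦ t + ∑ i, ∫ exp (sᵢ)`, with upper limits `yᵢ - t`; as `sᵢ ζ - ζ` does not
increase, each integral is a concave function of quantity. The bound alone makes the preference
regular.

Since `w` is continuous in `y`, the bounds at `x` and at `y` together show that `U` is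
differentiable with the budget shares as gradient. Hence no other prices support `y`, which gives
demand exactly, and any other log utility supported by the same prices differs from `U` by a
constant, which gives uniqueness. A change of location translates shares and index together, and
leaves inverse demand unchanged.
-/

open MeasureTheory
open scoped Topology

namespace HSA

section Calculus

theorem lipschitzWith_one_of_monotone_of_antitone_sub_id {g : ℝ → ℝ} (hg : Monotone g)
    (hg' : Antitone fun t => g t - t) : LipschitzWith 1 g := by
  refine LipschitzWith.of_le_add fun x y => ?_
  rcases le_total x y with hxy | hyx
  · exact (hg hxy).trans (le_add_of_nonneg_right dist_nonneg)
  · have hsub : g x - x ≤ g y - y := hg' hyx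
    have hdist : x - y ≤ dist x y := le_abs_self _
    linarith

theorem integral_le_integral_of_single_crossing {g h : ℝ → ℝ} {a b : ℝ}
    (hg : IntervalIntegrable g volume a b) (hh : IntervalIntegrable h volume a b)
    (hright : ∀ t, a ≤ t → g t ≤ h t) (hleft : ∀ t, t ≤ a → h t ≤ g t) :
    ∫ t in a..b, g t ≤ ∫ t in a..b, h t := by
  rcases le_total a b with hab | hba
  · exact intervalIntegral.integral_mono_on hab hg hh fun t ht => hright t ht.1
  · rw [intervalIntegral.integral_symm b a, intervalIntegral.integral_symm b a, neg_le_neg_iff]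
    exact intervalIntegral.integral_mono_on hba hh.symm hg.symm fun t ht => hleft t ht.2

theorem mul_sub_le_integral_of_monotone {h : ℝ → ℝ} (hh : Monotone h) (a b : ℝ) :
    h a * (b - a) ≤ ∫ t in a..b, h t := by
  calc h a * (b - a) = ∫ _ in a..b, h a := by
        rw [intervalIntegral.integral_const, smul_eq_mul, mul_comm]
    _ ≤ ∫ t in a..b, h t :=
        integral_le_integral_of_single_crossing intervalIntegrable_const hh.intervalIntegrable
          (fun _ ht => hh ht) fun _ ht => hh ht

theorem integral_exp_le_mul_exp_sub_exp {g : ℝ → ℝ} (hc : Continuous g)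
    (hg : Antitone fun t => g t - t) (a b : ℝ) :
    ∫ t in a..b, Real.exp (g t) ≤ Real.exp (g a - a) * (Real.exp b - Real.exp a) := by
  have hexp : ∀ t, Real.exp (g t) = Real.exp (g t - t) * Real.exp t := fun t => by
    rw [← Real.exp_add, sub_add_cancel]
  have hle : ∀ {t t'}, t ≤ t' → Real.exp (g t' - t') ≤ Real.exp (g t - t) := fun h =>
    Real.exp_le_exp.2 (hg h)
  calc ∫ t in a..b, Real.exp (g t) ≤ ∫ t in a..b, Real.exp (g a - a) * Real.exp t := by
        refine integral_le_integral_of_single_crossing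
          (Continuous.intervalIntegrable (by fun_prop) _ _)
          (Continuous.intervalIntegrable (by fun_prop) _ _) (fun t ht => ?_) fun t ht => ?_
        all_goals
          rw [hexp t]
          exact mul_le_mul_of_nonneg_right (hle ht) (Real.exp_pos t).le
    _ = Real.exp (g a - a) * (Real.exp b - Real.exp a) := by
        rw [intervalIntegral.integral_const_mul, integral_exp]

end Calculus

section AdditivelyHomogeneous

variable {ι : Type*} {F : (ι → ℝ) → ℝ}

theorem nonempty_of_apply_add_const (hF : ∀ y c, F (fun i => y i + c) = F y + c) :
    Nonempty ι := by
  by_contra hι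
  rw [not_nonempty_iff] at hι
  have h := hF 0 1
  rw [Subsingleton.elim (fun i => (0 : ι → ℝ) i + 1) 0] at h
  linarith

theorem continuous_of_monotone_of_apply_add_const [Finite ι] (hmono : Monotone F)
    (hF : ∀ y c, F (fun i => y i + c) = F y + c) : Continuous F := by
  cases nonempty_fintype ι
  refine (LipschitzWith.of_le_add fun x y => ?_).continuous
  rw [← hF]
  refine hmono fun i => ?_
  have hdist := (le_abs_self (x i - y i)).trans (dist_le_pi_dist x y i)
  linarith

end AdditivelyHomogeneous

section Cost

variable {ι : Type*} [Fintype ι] {v w x y : ι → ℝ}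

/-- The cost, at prices `w` in levels, of the bundle with log quantities `x`. -/
noncomputable def cost (w x : ι → ℝ) : ℝ := ∑ i, w i * Real.exp (x i)

/-- The differential of `cost w` at `y`. When `y` costs one unit at the prices `w`, its coefficients
are the budget shares of `y`. -/
noncomputable def costDeriv (w y : ι → ℝ) : (ι → ℝ) →L[ℝ] ℝ :=
  ∑ i, (w i * Real.exp (y i)) • ContinuousLinearMap.proj i

theorem cost_add_const (w x : ι → ℝ) (c : ℝ) :
    cost w (fun i => x i + c) = cost w x * Real.exp c := by
  simp only [cost, Real.exp_add, Finset.sum_mul, mul_assoc]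

theorem cost_pos [Nonempty ι] (hw : ∀ i, 0 < w i) (x : ι → ℝ) : 0 < cost w x :=
  Finset.sum_pos (fun i _ => mul_pos (hw i) (Real.exp_pos _)) Finset.univ_nonempty

theorem cost_le_cost (hw : ∀ i, 0 < w i) (hxy : x ≤ y) : cost w x ≤ cost w y :=
  Finset.sum_le_sum fun i _ => mul_le_mul_of_nonneg_left (Real.exp_le_exp.2 (hxy i)) (hw i).le

theorem cost_lt_cost [Nonempty ι] (hw : ∀ i, 0 < w i) (hxy : ∀ i, x i < y i) :
    cost w x < cost w y :=
  Finset.sum_lt_sum_of_nonempty Finset.univ_nonempty fun i _ =>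
    mul_lt_mul_of_pos_left (Real.exp_lt_exp.2 (hxy i)) (hw i)

theorem hasFDerivAt_cost (w y : ι → ℝ) : HasFDerivAt (cost w) (costDeriv w y) y := by
  refine HasFDerivAt.fun_sum fun i _ => ?_
  rw [mul_smul]
  exact (hasFDerivAt_apply i y).exp.const_mul (w i)

theorem costDeriv_inj : costDeriv v y = costDeriv w y ↔ v = w := by
  classical
  refine ⟨fun h => funext fun i => ?_, fun h => by rw [h]⟩
  have hi := congrArg (fun L : (ι → ℝ) →L[ℝ] ℝ => L (Pi.single i 1)) h
  simpa [costDeriv, Pi.single_apply] using hi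

theorem sum_sub_mul_exp_sub_exp (v w x y : ι → ℝ) :
    ∑ i, (v i - w i) * (Real.exp (y i) - Real.exp (x i)) =
      cost v y - cost v x - (cost w y - cost w x) := by
  simp only [cost, ← Finset.sum_sub_distrib]
  exact Finset.sum_congr rfl fun i _ => by ring

theorem mem_budget_iff {N : ℕ} {p x : Fin N → ℝ} {Φ : ℝ} :
    x ∈ budget p Φ ↔ cost (fun i => Real.exp (p i - Φ)) x ≤ 1 := by
  have hsum : ∑ i, Real.exp (p i + x i) =
      Real.exp Φ * cost (fun i => Real.exp (p i - Φ)) x := by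
    simp only [cost, Finset.mul_sum, ← Real.exp_add]
    exact Finset.sum_congr rfl fun i _ => by ring_nf
  rw [budget, Set.mem_ofPred_eq, hsum, mul_le_iff_le_one_right (Real.exp_pos Φ)]

end Cost

/-- The prices `w`, in levels and with expenditure one, support the log utility `U` at the log
bundle `y`: `y` exhausts the budget, and a bundle of cost `e ^ c` is worth at most `U y + c`. The
bound is the homothetic form of utility maximization at `y`. -/
structure Supports {ι : Type*} [Fintype ι] (w : ι → ℝ) (U : (ι → ℝ) → ℝ) (y : ι → ℝ) : Prop where
  pos : ∀ i, 0 < w i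
  cost_eq_one : cost w y = 1
  sub_le_log_cost : ∀ x, U x - U y ≤ Real.log (cost w x)

/-- The preference represented by `U`. -/
def inducedPreference {N : ℕ} (U : (Fin N → ℝ) → ℝ) (x y : Fin N → ℝ) : Prop := U y ≤ U x

theorem represents_inducedPreference {N : ℕ} (U : (Fin N → ℝ) → ℝ) :
    Represents U (inducedPreference U) := fun _ _ => Iff.rfl

theorem Represents.eq_inducedPreference {N : ℕ} {U : (Fin N → ℝ) → ℝ}
    {R : (Fin N → ℝ) → (Fin N → ℝ) → Prop} (h : Represents U R) : R = inducedPreference U := by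
  ext x y
  exact h x y

namespace Supports

variable {ι : Type*} [Fintype ι] {U : (ι → ℝ) → ℝ} {w x y : ι → ℝ}

theorem nonempty (h : Supports w U y) : Nonempty ι := by
  by_contra hι
  rw [not_nonempty_iff] at hι
  simpa [cost] using h.cost_eq_one

theorem apply_le (h : Supports w U y) (hx : cost w x ≤ 1) : U x ≤ U y := by
  have := h.nonempty
  exact sub_nonpos.1 ((h.sub_le_log_cost x).trans (Real.log_nonpos (cost_pos h.pos x).le hx))

theorem apply_lt (h : Supports w U y) (hx : cost w x < 1) : U x < U y := by
  have := h.nonempty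
  exact sub_neg.1 ((h.sub_le_log_cost x).trans_lt (Real.log_neg (cost_pos h.pos x) hx))

theorem apply_add_const_le (h : Supports w U y) (c : ℝ) : U (fun i => y i + c) ≤ U y + c := by
  have hc := h.sub_le_log_cost fun i => y i + c
  rw [cost_add_const, h.cost_eq_one, one_mul, Real.log_exp] at hc
  linarith

theorem sub_le_cost_sub_one (h : Supports w U y) (x : ι → ℝ) : U x - U y ≤ cost w x - 1 := by
  have := h.nonempty
  exact (h.sub_le_log_cost x).trans (Real.log_le_sub_one_of_pos (cost_pos h.pos x))

theorem eq_costDeriv (h : Supports w U y) {L : (ι → ℝ) →L[ℝ] ℝ} (hL : HasFDerivAt U L y) :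
    L = costDeriv w y := by
  have hmax : IsLocalMax (fun x => U x - cost w x) y := Filter.Eventually.of_forall fun x => by
    linarith [h.sub_le_cost_sub_one x, h.cost_eq_one]
  exact sub_eq_zero.1 (hmax.hasFDerivAt_eq_zero (hL.sub (hasFDerivAt_cost w y)))

end Supports

section SupportedUtility

variable {ι : Type*} [Fintype ι] {U V : (ι → ℝ) → ℝ} {w : (ι → ℝ) → ι → ℝ}

theorem apply_add_const_of_supports (h : ∀ y, Supports (w y) U y) (y : ι → ℝ) (c : ℝ) :
    U (fun i => y i + c) = U y + c := by
  refine ((h y).apply_add_const_le c).antisymm ?_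
  have hback := (h fun i => y i + c).apply_add_const_le (-c)
  simp only [add_neg_cancel_right] at hback
  linarith

theorem continuous_of_supports (h : ∀ y, Supports (w y) U y) : Continuous U := by
  refine continuous_of_monotone_of_apply_add_const (fun x y hxy => ?_)
    (apply_add_const_of_supports h)
  exact (h y).apply_le ((cost_le_cost (h y).pos hxy).trans_eq (h y).cost_eq_one)

/-- In quantities, the upper contour set is the intersection of the positive orthant with the open
half-spaces of bundles that are too expensive at the prices supporting a worse bundle. -/
theorem convex_image_exp_of_supports (h : ∀ y, Supports (w y) U y) (r : ℝ) :
    Convex ℝ ((fun (y : ι → ℝ) (i : ι) => Real.exp (y i)) '' {y | r ≤ U y}) := by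
  have himage : (fun (y : ι → ℝ) (i : ι) => Real.exp (y i)) '' {y | r ≤ U y} =
      (Set.univ.pi fun _ => Set.Ioi 0) ∩
        ⋂ m ∈ {m | U m < r}, {X : ι → ℝ | 1 < w m ⬝ᵥ X} := by
    ext X
    simp only [Set.mem_inter_iff, Set.mem_iInter₂, Set.mem_ofPred_eq, Set.mem_univ_pi, Set.mem_Ioi]
    constructor
    · rintro ⟨x, hx, rfl⟩
      refine ⟨fun i => Real.exp_pos _, fun m hm => ?_⟩
      by_contra! hcost
      exact ((h m).apply_le hcost).not_gt (hm.trans_le hx)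
    · rintro ⟨hX, hcost⟩
      obtain ⟨x, rfl⟩ : ∃ x : ι → ℝ, (fun i => Real.exp (x i)) = X :=
        ⟨fun i => Real.log (X i), funext fun i => Real.exp_log (hX i)⟩
      refine ⟨x, ?_, rfl⟩
      by_contra! hx
      exact (hcost x (not_le.1 hx)).ne' (h x).cost_eq_one
  rw [himage]
  exact (convex_pi fun _ _ => convex_Ioi 0).inter <| convex_iInter₂ fun m _ =>
    convex_halfSpace_gt ⟨dotProduct_add (w m), fun c X => dotProduct_smul c (w m) X⟩ 1

/-- Bounding `U x - U y` above by the prices at `y` and below by the prices at `x` leaves a gap of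
second order. -/
theorem hasFDerivAt_of_supports (h : ∀ y, Supports (w y) U y) {y : ι → ℝ}
    (hw : ContinuousAt w y) : HasFDerivAt U (costDeriv (w y) y) y := by
  have hgap : ∀ x, ‖U x - cost (w y) x - (U y - cost (w y) y)‖ ≤
      1 * ‖∑ i, (w y i - w x i) * (Real.exp (x i) - Real.exp (y i))‖ := fun x => by
    rw [one_mul, sum_sub_mul_exp_sub_exp, (h x).cost_eq_one, (h y).cost_eq_one]
    have hupper := (h y).sub_le_cost_sub_one x
    have hlower := (h x).sub_le_cost_sub_one y
    rw [Real.norm_eq_abs, Real.norm_eq_abs, abs_le]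
    constructor <;> linarith [le_abs_self (cost (w y) x - 1 - (1 - cost (w x) y))]
  have hsmall : (fun x => ∑ i, (w y i - w x i) * (Real.exp (x i) - Real.exp (y i)))
      =o[𝓝 y] fun x => ‖x - y‖ := by
    refine Asymptotics.IsLittleO.fun_sum fun i _ => ?_
    have hprice : (fun x => w y i - w x i) =o[𝓝 y] fun _ => (1 : ℝ) := by
      rw [Asymptotics.isLittleO_one_iff]
      simpa using (continuousAt_pi.1 hw i).const_sub (w y i)
    have hexp : (fun x : ι → ℝ => Real.exp (x i) - Real.exp (y i)) =O[𝓝 y] fun x => ‖x - y‖ :=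
      (hasFDerivAt_apply i y).exp.isBigO_sub.norm_right
    simpa using hprice.mul_isBigO hexp
  have hrest : HasFDerivAt (fun x => U x - cost (w y) x) (0 : (ι → ℝ) →L[ℝ] ℝ) y := by
    rw [hasFDerivAt_iff_isLittleO]
    have hbound := Asymptotics.IsBigO.of_bound (l := 𝓝 y) 1 (.of_forall hgap)
    simpa using (hbound.trans_isLittleO hsmall).of_norm_right
  simpa using hrest.fun_add (hasFDerivAt_cost (w y) y)

theorem supports_iff_eq (h : ∀ y, Supports (w y) U y) {y v : ι → ℝ} (hw : ContinuousAt w y) :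
    Supports v U y ↔ v = w y := by
  refine ⟨fun hv => ?_, fun hv => hv ▸ h y⟩
  exact (costDeriv_inj.1 (hv.eq_costDeriv (hasFDerivAt_of_supports h hw))).symm

theorem sub_eq_sub_of_supports (hU : ∀ y, Supports (w y) U y) (hV : ∀ y, Supports (w y) V y)
    (hw : Continuous w) (x y : ι → ℝ) : U x - V x = U y - V y := by
  have hderiv : ∀ y, HasFDerivAt (fun x => U x - V x) (0 : (ι → ℝ) →L[ℝ] ℝ) y := fun y => by
    simpa using (hasFDerivAt_of_supports hU hw.continuousAt).fun_sub
      (hasFDerivAt_of_supports hV hw.continuousAt)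
  exact is_const_of_fderiv_eq_zero (𝕜 := ℝ) (fun y => (hderiv y).differentiableAt)
    (fun y => (hderiv y).fderiv) x y

end SupportedUtility

section Preference

variable {N : ℕ} {R : (Fin N → ℝ) → (Fin N → ℝ) → Prop} {U : (Fin N → ℝ) → ℝ}

theorem isRegularPreference_of_supports {w : (Fin N → ℝ) → Fin N → ℝ}
    (h : ∀ y, Supports (w y) U y) : IsRegularPreference (inducedPreference U) where
  complete _ _ := le_total _ _
  transitive _ _ _ hxy hyw := hyw.trans hxy
  monotone x y hxy := by
    have := (h y).nonempty
    have hlt := (h y).apply_lt ((cost_lt_cost (h y).pos hxy).trans_eq (h y).cost_eq_one)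
    exact ⟨hlt.le, hlt.not_ge⟩
  convex x := convex_image_exp_of_supports h (U x)
  closed_upper _ := isClosed_le continuous_const (continuous_of_supports h)
  closed_lower _ := isClosed_le (continuous_of_supports h) continuous_const
  homothetic x y c hxy := by
    rw [inducedPreference, apply_add_const_of_supports h, apply_add_const_of_supports h]
    exact add_le_add_left hxy c

theorem isDemanded_iff_supports (hU : Represents U R)
    (hadd : ∀ y c, U (fun i => y i + c) = U y + c) (p : Fin N → ℝ) (Φ : ℝ) (y : Fin N → ℝ) :
    IsDemanded R p Φ y ↔ Supports (fun i => Real.exp (p i - Φ)) U y := by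
  have := nonempty_of_apply_add_const hadd
  set w : Fin N → ℝ := fun i => Real.exp (p i - Φ)
  have hw : ∀ i, 0 < w i := fun i => Real.exp_pos _
  constructor
  · rintro ⟨hy, hbest⟩
    have hlog : ∀ x, U x - U y ≤ Real.log (cost w x) := fun x => by
      have hx : (fun i => x i + -Real.log (cost w x)) ∈ budget p Φ := by
        rw [mem_budget_iff, cost_add_const, Real.exp_neg, Real.exp_log (cost_pos hw x)]
        exact (mul_inv_cancel₀ (cost_pos hw x).ne').le
      have hle := (hU _ _).1 (hbest _ hx)
      rw [hadd] at hle
      linarith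
    have hcost : 0 ≤ Real.log (cost w y) := by simpa using hlog y
    exact ⟨hw, (mem_budget_iff.1 hy).antisymm ((Real.log_nonneg_iff (cost_pos hw y)).1 hcost), hlog⟩
  · exact fun h => ⟨mem_budget_iff.2 h.cost_eq_one.le, fun x hx =>
      (hU _ _).2 (h.apply_le (mem_budget_iff.1 hx))⟩

theorem IsRegularPreference.const_iff (hR : IsRegularPreference R) {c d : ℝ} :
    R (fun _ => c) (fun _ => d) ↔ d ≤ c := by
  constructor
  · intro h
    by_contra! hcd
    exact (hR.monotone _ _ fun _ => hcd).2 h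
  · intro h
    rcases h.eq_or_lt with rfl | hlt
    · exact or_self_iff.1 (hR.complete _ _)
    · exact (hR.monotone _ _ fun _ => hlt).1

theorem IsRegularPreference.exists_const_indifferent (hR : IsRegularPreference R)
    (y : Fin N → ℝ) : ∃ c : ℝ, R y (fun _ => c) ∧ R (fun _ => c) y := by
  have hconst : Continuous fun (c : ℝ) (_ : Fin N) => c := by fun_prop
  have hy : ∀ i, |y i| ≤ ‖y‖ := norm_le_pi_norm y
  have hworse : R y fun _ => -‖y‖ - 1 :=
    (hR.monotone _ _ fun i => by linarith [neg_abs_le (y i), hy i]).1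
  have hbetter : R (fun _ => ‖y‖ + 1) y :=
    (hR.monotone _ _ fun i => by linarith [le_abs_self (y i), hy i]).1
  obtain ⟨c, -, hc⟩ := isPreconnected_closed_iff.1 (isPreconnected_univ (α := ℝ)) _ _
    ((hR.closed_lower y).preimage hconst) ((hR.closed_upper y).preimage hconst)
    (fun c _ => hR.complete y fun _ => c) ⟨_, trivial, hworse⟩ ⟨_, trivial, hbetter⟩
  exact ⟨c, hc⟩

theorem IsRegularPreference.exists_represents (hR : IsRegularPreference R) :
    ∃ V, Represents V R ∧ ∀ y c, V (fun i => y i + c) = V y + c := by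
  choose V hge hle using hR.exists_const_indifferent
  have hrep : Represents V R := fun x y => by
    rw [← hR.const_iff]
    exact ⟨fun h => hR.transitive _ _ _ (hle x) (hR.transitive _ _ _ h (hge y)),
      fun h => hR.transitive _ _ _ (hge x) (hR.transitive _ _ _ h (hle y))⟩
  refine ⟨V, hrep, fun y c => le_antisymm ?_ ?_⟩
  · exact hR.const_iff.1 (hR.transitive _ _ _ (hR.homothetic _ _ c (hle y)) (hge _))
  · exact hR.const_iff.1 (hR.transitive _ _ _ (hle _) (hR.homothetic _ _ c (hge y)))

theorem IsRegularPreference.represents_of_supports {w : (Fin N → ℝ) → Fin N → ℝ}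
    (hR : IsRegularPreference R) (hU : ∀ y, Supports (w y) U y) (hw : Continuous w)
    (hdem : ∀ y, IsDemanded R (fun i => Real.log (w y i)) 0 y) :
    Represents U R := by
  obtain ⟨V, hVR, hadd⟩ := hR.exists_represents
  have hV : ∀ y, Supports (w y) V y := fun y => by
    simpa only [sub_zero, Real.exp_log ((hU y).pos _)] using
      (isDemanded_iff_supports hVR hadd _ _ y).1 (hdem y)
  intro x y
  have hconst := sub_eq_sub_of_supports hU hV hw x y
  rw [hVR x y]
  constructor <;> intro h <;> linarith

end Preference

section ShareSystem

variable {ι : Type*} [Fintype ι] {f : ι → ℝ → ℝ} {Q : (ι → ℝ) → ℝ}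

/-- An HSA demand system at fixed demand shifters: the log budget-share functions `f` of the
products, whose revenues increase and whose inverse demands do not, with an index `Q` that makes the
shares add up. -/
structure IsShareSystem (f : ι → ℝ → ℝ) (Q : (ι → ℝ) → ℝ) : Prop where
  strictMono : ∀ i, StrictMono (f i)
  antitone_sub : ∀ i, Antitone fun t => f i t - t
  sum_eq_one : ∀ y, ∑ i, Real.exp (f i (y i - Q y)) = 1

/-- `logUtility` at fixed demand shifters. -/
noncomputable def systemUtility (f : ι → ℝ → ℝ) (Q : (ι → ℝ) → ℝ) (b y : ι → ℝ) : ℝ :=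
  Q y + ∑ i, ∫ t in (b i)..(y i - Q y), Real.exp (f i t)

/-- The inverse demand of a share system in levels, at unit expenditure. -/
noncomputable def relPrice (f : ι → ℝ → ℝ) (Q : (ι → ℝ) → ℝ) (y : ι → ℝ) (i : ι) : ℝ :=
  Real.exp (f i (y i - Q y) - y i)

namespace IsShareSystem

theorem nonempty (hS : IsShareSystem f Q) : Nonempty ι := by
  by_contra hι
  rw [not_nonempty_iff] at hι
  simpa using hS.sum_eq_one 0

theorem continuous_share (hS : IsShareSystem f Q) (i : ι) : Continuous (f i) :=
  (lipschitzWith_one_of_monotone_of_antitone_sub_id (hS.strictMono i).monotone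
    (hS.antitone_sub i)).continuous

theorem strictAnti_sum_exp (hS : IsShareSystem f Q) (y : ι → ℝ) :
    StrictAnti fun t => ∑ i, Real.exp (f i (y i - t)) := fun _ _ hst =>
  have := hS.nonempty
  Finset.sum_lt_sum_of_nonempty Finset.univ_nonempty fun i _ =>
    Real.exp_lt_exp.2 (hS.strictMono i (sub_lt_sub_left hst (y i)))

theorem eq_index (hS : IsShareSystem f Q) {y : ι → ℝ} {t : ℝ}
    (ht : ∑ i, Real.exp (f i (y i - t)) = 1) : t = Q y :=
  (hS.strictAnti_sum_exp y).injective (ht.trans (hS.sum_eq_one y).symm)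

theorem monotone_index (hS : IsShareSystem f Q) : Monotone Q := fun x y hxy => by
  rw [← (hS.strictAnti_sum_exp x).le_iff_ge, hS.sum_eq_one, ← hS.sum_eq_one y]
  exact Finset.sum_le_sum fun i _ =>
    Real.exp_le_exp.2 ((hS.strictMono i).monotone (sub_le_sub_right (hxy i) _))

theorem index_add_const (hS : IsShareSystem f Q) (y : ι → ℝ) (c : ℝ) :
    Q (fun i => y i + c) = Q y + c := by
  refine (hS.eq_index ?_).symm
  simpa only [add_sub_add_right_eq_sub] using hS.sum_eq_one y

theorem index_const_neg (hS : IsShareSystem f Q) : Q (fun _ => -Q 0) = 0 := by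
  simpa only [Pi.zero_apply, zero_add, add_neg_cancel] using hS.index_add_const 0 (-Q 0)

theorem cost_relPrice (hS : IsShareSystem f Q) (y : ι → ℝ) : cost (relPrice f Q y) y = 1 := by
  simp only [cost, relPrice, ← Real.exp_add, sub_add_cancel, hS.sum_eq_one]

theorem continuous_relPrice (hS : IsShareSystem f Q) : Continuous (relPrice f Q) := by
  have hQ := continuous_of_monotone_of_apply_add_const hS.monotone_index hS.index_add_const
  refine continuous_pi fun i => ?_
  have hf := hS.continuous_share i
  unfold relPrice
  fun_prop

theorem integral_sub_integral (hS : IsShareSystem f Q) (i : ι) (a b c : ℝ) :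
    (∫ t in a..c, Real.exp (f i t)) - ∫ t in a..b, Real.exp (f i t) =
      ∫ t in b..c, Real.exp (f i t) := by
  have hc : Continuous fun t => Real.exp (f i t) :=
    Real.continuous_exp.comp (hS.continuous_share i)
  exact intervalIntegral.integral_interval_sub_left (hc.intervalIntegrable _ _)
    (hc.intervalIntegrable _ _)

/-- Adding up is the first-order condition for the index to minimize the right-hand side, a convex
function of `t`. -/
theorem systemUtility_le (hS : IsShareSystem f Q) (b x : ι → ℝ) (t : ℝ) :
    systemUtility f Q b x ≤ t + ∑ i, ∫ ζ in (b i)..(x i - t), Real.exp (f i ζ) := by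
  have hterm : ∀ i, Real.exp (f i (x i - Q x)) * (Q x - t) ≤
      (∫ ζ in (b i)..(x i - t), Real.exp (f i ζ)) -
        ∫ ζ in (b i)..(x i - Q x), Real.exp (f i ζ) := fun i => by
    rw [hS.integral_sub_integral, ← sub_sub_sub_cancel_left t (Q x) (x i)]
    exact mul_sub_le_integral_of_monotone
      (Real.exp_monotone.comp (hS.strictMono i).monotone) (x i - Q x) (x i - t)
  have hsum := Finset.sum_le_sum fun i (_ : i ∈ Finset.univ) => hterm i
  rw [← Finset.sum_mul, hS.sum_eq_one, Finset.sum_sub_distrib] at hsum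
  rw [systemUtility]
  linarith

theorem systemUtility_le_add_cost (hS : IsShareSystem f Q) (b x y : ι → ℝ) (c : ℝ) :
    systemUtility f Q b x ≤
      systemUtility f Q b y + c + (cost (relPrice f Q y) (fun i => x i + -c) - 1) := by
  have hterm : ∀ i, (∫ t in (b i)..(x i - (Q y + c)), Real.exp (f i t)) -
        ∫ t in (b i)..(y i - Q y), Real.exp (f i t) ≤
      relPrice f Q y i * Real.exp (x i + -c) - relPrice f Q y i * Real.exp (y i) := fun i => by
    rw [hS.integral_sub_integral]
    refine (integral_exp_le_mul_exp_sub_exp (hS.continuous_share i) (hS.antitone_sub i)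
      _ _).trans_eq ?_
    simp only [relPrice, mul_sub, ← Real.exp_add]
    ring_nf
  have hsum := Finset.sum_le_sum fun i (_ : i ∈ Finset.univ) => hterm i
  rw [Finset.sum_sub_distrib, Finset.sum_sub_distrib, ← cost, ← cost, hS.cost_relPrice] at hsum
  have hindex := hS.systemUtility_le b x (Q y + c)
  rw [systemUtility.eq_def f Q b y]
  linarith

theorem supports_systemUtility (hS : IsShareSystem f Q) (b y : ι → ℝ) :
    Supports (relPrice f Q y) (systemUtility f Q b) y := by
  have := hS.nonempty
  have hpos : ∀ i, 0 < relPrice f Q y i := fun i => Real.exp_pos _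
  refine ⟨hpos, hS.cost_relPrice y, fun x => ?_⟩
  have hle := hS.systemUtility_le_add_cost b x y (Real.log (cost (relPrice f Q y) x))
  rw [cost_add_const, Real.exp_neg, Real.exp_log (cost_pos hpos x),
    mul_inv_cancel₀ (cost_pos hpos x).ne'] at hle
  linarith

theorem translate (hS : IsShareSystem f Q) (c : ℝ) :
    IsShareSystem (fun i t => f i (t - c)) (fun y => Q y - c) where
  strictMono i _ _ hst := hS.strictMono i (sub_lt_sub_right hst c)
  antitone_sub i t t' htt' := by
    have h : f i (t' - c) - (t' - c) ≤ f i (t - c) - (t - c) :=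
      hS.antitone_sub i (sub_le_sub_right htt' c)
    linarith
  sum_eq_one y := by simpa only [sub_sub, sub_add_cancel] using hS.sum_eq_one y

end IsShareSystem

end ShareSystem

section DemandSystem

variable {N : ℕ} {Z : Type*} {s : ShareFn Z} {q : IndexFn N Z} {z : Fin N → Z}
  {u : Fin N → unitInterval}

theorem logUtility_self {b : Fin N → ℝ} (hb : q b z u = 0) : logUtility s q b z u b = 0 := by
  simp only [logUtility, hb, sub_zero, intervalIntegral.integral_same, Finset.sum_const_zero,
    add_zero]

namespace IsShareSystem

theorem supports_logUtility (hS : IsShareSystem (fun i t => s t (z i) (u i)) fun y => q y z u)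
    (b y : Fin N → ℝ) :
    Supports (relPrice (fun i t => s t (z i) (u i)) (fun y => q y z u) y)
      (logUtility s q b z u) y :=
  hS.supports_systemUtility b y

theorem isRegularPreference
    (hS : IsShareSystem (fun i t => s t (z i) (u i)) fun y => q y z u) (b : Fin N → ℝ) :
    IsRegularPreference (inducedPreference (logUtility s q b z u)) :=
  isRegularPreference_of_supports (hS.supports_logUtility b)

theorem generates (hS : IsShareSystem (fun i t => s t (z i) (u i)) fun y => q y z u)
    (b : Fin N → ℝ) : Generates (inducedPreference (logUtility s q b z u)) s q z u := by
  intro p Φ y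
  have hsupp := hS.supports_logUtility b
  rw [isDemanded_iff_supports (represents_inducedPreference _)
      (apply_add_const_of_supports hsupp),
    supports_iff_eq hsupp hS.continuous_relPrice.continuousAt, funext_iff]
  refine forall_congr' fun i => ?_
  rw [relPrice, Real.exp_eq_exp, logPrice]
  constructor <;> intro h <;> linarith

theorem represents_of_generates
    (hS : IsShareSystem (fun i t => s t (z i) (u i)) fun y => q y z u) (b : Fin N → ℝ)
    {R : (Fin N → ℝ) → (Fin N → ℝ) → Prop} (hR : IsRegularPreference R)
    (hgen : Generates R s q z u) : Represents (logUtility s q b z u) R := by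
  refine hR.represents_of_supports (hS.supports_logUtility b) hS.continuous_relPrice fun y => ?_
  refine (hgen _ 0 y).2 fun i => ?_
  rw [relPrice, Real.log_exp, logPrice, zero_add]

theorem logPrice_add_const (hS : IsShareSystem (fun i t => s t (z i) (u i)) fun y => q y z u)
    (Φ : ℝ) (y : Fin N → ℝ) (c : ℝ) (i : Fin N) :
    logPrice s q z u Φ (fun j => y j + c) i = logPrice s q z u Φ y i - c := by
  rw [logPrice, logPrice, hS.index_add_const, add_sub_add_right_eq_sub]
  ring

end IsShareSystem

end DemandSystem

section Location

variable {N : ℕ} {Z : Type*} {s : ShareFn Z} {q : IndexFn N Z}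

/-- A share function under a change of the units of log quantities by `c`. -/
def ShareFn.translate (s : ShareFn Z) (c : ℝ) : ShareFn Z := fun t z u => s (t - c) z u

theorem IsLocationShift.eq_translate {a : ℝ} {φ φ' : ShareFn Z} (h : IsLocationShift a φ φ')
    (hφ : ∀ z u, Function.Injective fun y => φ y z u) : φ' = φ.translate a := by
  funext y z u
  obtain ⟨hrange, hinv⟩ := h z u
  have hmem : φ (y - a) z u ∈ Set.range fun y => φ y z u := ⟨y - a, rfl⟩
  have hφinv : revInv φ (φ (y - a) z u) z u = y - a :=
    Function.leftInverse_invFun (hφ z u) (y - a)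
  have hφ'inv : φ' (revInv φ' (φ (y - a) z u) z u) z u = φ (y - a) z u :=
    Function.invFun_eq (f := fun y => φ' y z u) (by rwa [← hrange] at hmem)
  rwa [hinv _ hmem, hφinv, add_sub_cancel] at hφ'inv

theorem reducedShare_eq_translate {a Φ₀ q₀ : ℝ} {φ' : ShareFn Z}
    (h : IsLocationShift a (fun y z u => Φ₀ + s (y - q₀) z u) φ')
    (hs : ∀ z u, Function.Injective fun t => s t z u) :
    reducedShare φ' Φ₀ = s.translate (q₀ + a) := by
  rw [h.eq_translate fun z u => (add_right_injective Φ₀).comp <|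
    (hs z u).comp (sub_left_injective (b := q₀))]
  funext t z u
  simp only [reducedShare, ShareFn.translate, add_sub_cancel_left, sub_sub, add_comm q₀]

theorem addingUp_translate_iff {c : ℝ} {q' : IndexFn N Z}
    (hS : ∀ z u, IsShareSystem (fun i t => s t (z i) (u i)) fun y => q y z u) :
    AddingUp (s.translate c) q' ↔ q' = fun y z u => q y z u - c := by
  constructor
  · intro h
    funext y z u
    exact ((hS z u).translate c).eq_index (h y z u)
  · rintro rfl y z u
    exact ((hS z u).translate c).sum_eq_one y

theorem logPrice_translate (c : ℝ) :
    logPrice (s.translate c) (fun y z u => q y z u - c) = logPrice s q := by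
  funext z u Φ y i
  simp only [logPrice, ShareFn.translate, sub_sub, sub_add_cancel]

theorem generates_translate_iff {R : (Fin N → ℝ) → (Fin N → ℝ) → Prop} {z : Fin N → Z}
    {u : Fin N → unitInterval} (c : ℝ) :
    Generates R (s.translate c) (fun y z u => q y z u - c) z u ↔ Generates R s q z u := by
  simp only [Generates, logPrice_translate]

end Location

namespace Industry.Assumptions

variable {N : ℕ} {Z : Type*} {E : Industry N Z}

theorem share_strictMono (hE : E.Assumptions) (z : Z) (u : unitInterval) :
    StrictMono fun t => E.share t z u := by
  simpa [StrictMono, rev, hE.normalized] using hE.rev_strictMono z u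

theorem share_sub_antitone (hE : E.Assumptions) (z : Z) (u : unitInterval) :
    Antitone fun t => E.share t z u - t := by
  simpa [Antitone, invDemand, rev, hE.normalized, add_sub_assoc] using
    (hE.invDemand_strictAnti z u).antitone

end Industry.Assumptions

end HSA

open scoped unitInterval in
theorem mainTheorem5_general (N : ℕ) (Z : Type*) :
    ∃ bId : HSA.ShareFn Z → HSA.IndexFn N Z → (Fin N → Z) → (Fin N → I) → (Fin N → ℝ),
    ∀ (s : HSA.ShareFn Z) (q : HSA.IndexFn N Z), HSA.AddingUp s q →
      (∀ z u, StrictMono fun t => s t z u) → (∀ z u, Antitone fun t => s t z u - t) →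
      ∀ Φ₀ q₀ : ℝ,
      (∀ (a : ℝ) (φ' : HSA.ShareFn Z),
        HSA.IsLocationShift a (fun y z u => Φ₀ + s (y - q₀) z u) φ' →
        ∃! Δq' : HSA.IndexFn N Z, HSA.AddingUp (HSA.reducedShare φ' Φ₀) Δq') ∧
      ∀ (z : Fin N → Z) (u : Fin N → I),
        ∃ R : (Fin N → ℝ) → (Fin N → ℝ) → Prop,
          (HSA.IsRegularPreference R ∧ HSA.Generates R s q z u ∧
            ∀ R', HSA.IsRegularPreference R' → HSA.Generates R' s q z u → R' = R) ∧
          ∀ (a : ℝ) (φ' : HSA.ShareFn Z) (Δq' : HSA.IndexFn N Z),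
            HSA.IsLocationShift a (fun y z u => Φ₀ + s (y - q₀) z u) φ' →
            HSA.AddingUp (HSA.reducedShare φ' Φ₀) Δq' →
            ∀ s' : HSA.ShareFn Z, s' = HSA.reducedShare φ' Φ₀ →
            ∀ b : Fin N → ℝ, b = bId s' Δq' z u →
              (HSA.Represents (HSA.logUtility s' Δq' b z u) R ∧
                (∀ (y : Fin N → ℝ) (c : ℝ), HSA.logUtility s' Δq' b z u (fun i => y i + c) =
                  HSA.logUtility s' Δq' b z u y + c) ∧
                HSA.logUtility s' Δq' b z u b = 0) ∧
              ((∀ y, Δq' y z u = q y z u - q₀ - a) ∧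
                (∀ Φ y i, HSA.logPrice s' Δq' z u Φ y i = HSA.logPrice s q z u Φ y i) ∧
                (∀ Φ (y : Fin N → ℝ) i, HSA.logPrice s' Δq' z u Φ (fun j => y j + a) i =
                  HSA.logPrice s q z u Φ y i - a) ∧
                HSA.Generates R s' Δq' z u ∧
                ∀ R', HSA.IsRegularPreference R' → HSA.Generates R' s' Δq' z u → R' = R) := by
  refine ⟨fun _ q z u _ => -q 0 z u, fun s q hadd hmono hanti Φ₀ q₀ => ?_⟩
  have hS : ∀ z u, HSA.IsShareSystem (fun i t => s t (z i) (u i)) fun y => q y z u := fun z u =>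
    ⟨fun _ => hmono _ _, fun _ => hanti _ _, fun y => hadd y z u⟩
  have hinj := fun z u => (hmono z u).injective
  refine ⟨fun a φ' h => ?_, fun z u => ?_⟩
  · rw [HSA.reducedShare_eq_translate h hinj]
    exact ⟨_, (HSA.addingUp_translate_iff hS).2 rfl, fun _ => (HSA.addingUp_translate_iff hS).1⟩
  have hreg := (hS z u).isRegularPreference 0
  have hgen := (hS z u).generates 0
  have huniq : ∀ R', HSA.IsRegularPreference R' → HSA.Generates R' s q z u →
      R' = HSA.inducedPreference (HSA.logUtility s q 0 z u) := fun R' hR' hgen' =>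
    ((hS z u).represents_of_generates 0 hR' hgen').eq_inducedPreference
  refine ⟨_, ⟨hreg, hgen, huniq⟩, ?_⟩
  rintro a φ' Δq' h hΔq' _ rfl _ rfl
  rw [HSA.reducedShare_eq_translate h hinj] at hΔq' ⊢
  obtain rfl := (HSA.addingUp_translate_iff hS).1 hΔq'
  have hS' := (hS z u).translate (q₀ + a)
  have hgen' := (HSA.generates_translate_iff (q₀ + a)).2 hgen
  refine ⟨⟨hS'.represents_of_generates _ hreg hgen',
    HSA.apply_add_const_of_supports (hS'.supports_logUtility _),
    HSA.logUtility_self hS'.index_const_neg⟩, fun y => (sub_sub _ _ _).symm, ?_, ?_, hgen',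
    fun R' hR' hR'gen => huniq R' hR' ((HSA.generates_translate_iff _).1 hR'gen)⟩
  · simp only [HSA.logPrice_translate, implies_true]
  · simp only [HSA.logPrice_translate]
    exact fun Φ y i => (hS z u).logPrice_add_const Φ y a i

open scoped unitInterval in
theorem mainTheorem5 (N : ℕ) (Z : Type*) :
    -- the rule `bId` that computes the constants from the known share function and index
    ∃ bId : HSA.ShareFn Z → HSA.IndexFn N Z → (Fin N → Z) → (Fin N → I) → (Fin N → ℝ),
    ∀ E : HSA.Industry N Z, E.Assumptions →
      -- under every location normalization the adding-up constraint determines the index change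
      (∀ (a : ℝ) (φ' : HSA.ShareFn Z), HSA.IsLocationShift a E.rev φ' →
        ∃! Δq' : HSA.IndexFn N Z, HSA.AddingUp (HSA.reducedShare φ' E.Φ) Δq') ∧
      ∀ (z : Fin N → Z) (u : Fin N → I),
        ∃ R : (Fin N → ℝ) → (Fin N → ℝ) → Prop,
          -- (a)
          (HSA.IsRegularPreference R ∧ HSA.Generates R E.share E.index z u ∧
            ∀ R', HSA.IsRegularPreference R' → HSA.Generates R' E.share E.index z u → R' = R) ∧
          ∀ (a : ℝ) (φ' : HSA.ShareFn Z) (Δq' : HSA.IndexFn N Z),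
            HSA.IsLocationShift a E.rev φ' →
            HSA.AddingUp (HSA.reducedShare φ' E.Φ) Δq' →
            ∀ s' : HSA.ShareFn Z, s' = HSA.reducedShare φ' E.Φ →
            ∀ b : Fin N → ℝ, b = bId s' Δq' z u →
              -- (b)
              (HSA.Represents (HSA.logUtility s' Δq' b z u) R ∧
                (∀ (y : Fin N → ℝ) (c : ℝ), HSA.logUtility s' Δq' b z u (fun i => y i + c) =
                  HSA.logUtility s' Δq' b z u y + c) ∧
                HSA.logUtility s' Δq' b z u b = 0) ∧
              -- (c)
              ((∀ y, Δq' y z u = E.indexChange y z u - a) ∧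
                (∀ Φ y i, HSA.logPrice s' Δq' z u Φ y i =
                  HSA.logPrice E.share E.index z u Φ y i) ∧
                (∀ Φ (y : Fin N → ℝ) i, HSA.logPrice s' Δq' z u Φ (fun j => y j + a) i =
                  HSA.logPrice E.share E.index z u Φ y i - a) ∧
                HSA.Generates R s' Δq' z u ∧
                ∀ R', HSA.IsRegularPreference R' → HSA.Generates R' s' Δq' z u → R' = R) :=
  (mainTheorem5_general N Z).imp fun _ h E hE => h E.share E.index hE.adding_up
    hE.share_strictMono hE.share_sub_antitone E.Φ (E.index E.y₀ E.z₀ E.u₀)
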